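/- Let $G$ be a finite simple graph with at least one vertex. For a set $S\subseteq V(G)$ let $\Omega(G-S)$ denote the number of connected components of the graph obtained from $G$ by deleting the vertices of $S$. Suppose that $G$ is $2$-tough, i.e. $|S|\ge 2\,\Omega(G-S)$ for every $S\subseteq V(G)$ with $\Omega(G-S)>1$, and that $G$ is $2K_2$-free, i.e. $G$ has no induced subgraph isomorphic to $2K_2$, the graph on four vertices consisting of two vertex-disjoint edges. Then $G$ admits a $2$-walk, i.e. a closed walk that visits every vertex of $G$ at least once and at most twice, where the common start and end of the walk counts as a single visit (if $G$ has just one vertex, the closed walk of length $0$ is a $2$-walk). -/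

import Mathlib

namespace SimpleGraph

variable {V : Type*}

/-- The number `Ω(G - S)` of connected components of the graph obtained from `G` by deleting
the vertices of `S`. -/
noncomputable def numComponentsDelete (G : SimpleGraph V) (S : Finset V) : ℕ :=
  Nat.card (G.induce ((S : Set V)ᶜ)).ConnectedComponent

/-- A finite graph `G` is `β`-tough if `|S| ≥ β * Ω(G - S)` for every set `S` of vertices
with `Ω(G - S) > 1`. -/
def IsTough (G : SimpleGraph V) (β : ℝ) : Prop :=
  ∀ S : Finset V, 1 < G.numComponentsDelete S →
    β * (G.numComponentsDelete S : ℝ) ≤ (S.card : ℝ)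

/-- `2K₂`: the graph on four vertices consisting of two vertex-disjoint edges. -/
def twoKTwo : SimpleGraph (Fin 2 ⊕ Fin 2) :=
  SimpleGraph.sum (completeGraph (Fin 2)) (completeGraph (Fin 2))

/-- `G` is `2K₂`-free if it has no induced subgraph isomorphic to `2K₂`. -/
def IsTwoKTwoFree (G : SimpleGraph V) : Prop :=
  ¬ twoKTwo.IsIndContained G

/-- A closed walk is a `k`-walk (`k ≥ 1`) if it is spanning and visits each vertex at most `k`
times. The list of vertices of a closed walk starts and ends with the same visit to its base
vertex; taking the tail makes this visit count once. -/
def Walk.IsKWalk [DecidableEq V] {G : SimpleGraph V} {v : V} (p : G.Walk v v) (k : ℕ) : Prop :=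
  (∀ u : V, u ∈ p.support) ∧ ∀ u : V, p.support.tail.count u ≤ k

/-- `G` admits a `k`-walk. -/
def HasKWalk [DecidableEq V] (G : SimpleGraph V) (k : ℕ) : Prop :=
  ∃ (v : V) (p : G.Walk v v), p.IsKWalk k

end SimpleGraph

/-!
The argument only uses `1`-toughness. Call a cyclic sequence of at least two distinct vertices with
consecutive ones adjacent a *cycle* (so an edge traversed back and forth counts), and let `C` be a
longest one.

* `C` is dominating, i.e. every edge meets `C` (`exists_dominating_cycle`). Otherwise let `xy` be an
  edge off `C`, let `K` be the component of `G - C` containing it, and let `A` be the set of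
  vertices of `C` with a neighbour in `K`. Two consecutive vertices of `C` cannot both lie in `A`,
  since a path through `K` could be inserted between them (`exists_longer_cycle`); hence
  `B = C \ A` has at least `|A|` elements. An edge from `B` to a vertex outside `A` would form an
  induced `2K₂` with `xy`, so every vertex of `B` is isolated in `G - A`. Together with the
  component of `x` this gives at least `|B| + 1 > |A|` components of `G - A`, contradicting
  toughness.
* The vertices off `C` thus form an independent set, and toughness is Hall's condition for matching
  them into `C` (`exists_matching_of_independent`).
* Following `C` and making a detour `c, u, c` for each matching edge `uc` visits each vertex of `C`
  at most twice and every other vertex exactly once (`exists_closedWalk_with_detours`).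
-/

namespace SimpleGraph

/-! ### Toughness and isolated vertices -/

theorem IsTough.mono {V : Type*} {G : SimpleGraph V} {β γ : ℝ} (h : G.IsTough γ) (hβ : β ≤ γ) :
    G.IsTough β := fun S hS =>
  (mul_le_mul_of_nonneg_right hβ (Nat.cast_nonneg _)).trans (h S hS)

/-- If every vertex of `I` is isolated in `G - S` and `G - S` has a further vertex `x`, then the
vertices of `I` and `x` lie in different components of `G - S`. -/
theorem card_add_one_le_numComponentsDelete {V : Type*} [Finite V] (G : SimpleGraph V)
    {S I : Finset V} (hIS : Disjoint I S) (hN : ∀ v ∈ I, ∀ w, G.Adj v w → w ∈ S)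
    {x : V} (hxS : x ∉ S) (hxI : x ∉ I) : I.card + 1 ≤ G.numComponentsDelete S := by
  classical
  have hT : ∀ a ∈ insert x I, a ∈ ((S : Set V)ᶜ) := by
    intro a ha
    rcases Finset.mem_insert.1 ha with rfl | ha
    · simpa using hxS
    · simpa using Finset.disjoint_left.1 hIS ha
  have key : ∀ a b (ha : a ∈ ((S : Set V)ᶜ)) (hb : b ∈ ((S : Set V)ᶜ)), a ∈ I →
      (G.induce ((S : Set V)ᶜ)).Reachable ⟨a, ha⟩ ⟨b, hb⟩ → a = b := by
    rintro a b ha hb haI ⟨p⟩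
    cases p with
    | nil => rfl
    | @cons _ w _ h q =>
      exact absurd (hN a haI w.1 h) w.2
  let f : ↥(insert x I) → (G.induce ((S : Set V)ᶜ)).ConnectedComponent :=
    fun a => (G.induce ((S : Set V)ᶜ)).connectedComponentMk ⟨a.1, hT a.1 a.2⟩
  have hf : Function.Injective f := by
    rintro ⟨a, ha⟩ ⟨b, hb⟩ hab
    have hr := ConnectedComponent.exact hab
    apply Subtype.ext
    rcases Finset.mem_insert.1 ha with hax | haI
    · rcases Finset.mem_insert.1 hb with hbx | hbI
      · exact hax.trans hbx.symm
      · exact (key b a _ _ hbI hr.symm).symm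
    · exact key a b _ _ haI hr
  have := Nat.card_le_card_of_injective f hf
  rwa [Nat.card_eq_fintype_card, Fintype.card_coe, Finset.card_insert_of_notMem hxI] at this

theorem IsTough.card_add_one_le {V : Type*} [Finite V] {G : SimpleGraph V} (hG : G.IsTough 1)
    {S I : Finset V} (hIS : Disjoint I S) (hN : ∀ v ∈ I, ∀ w, G.Adj v w → w ∈ S)
    (hI : I.Nonempty) {x : V} (hxS : x ∉ S) (hxI : x ∉ I) : I.card + 1 ≤ S.card := by
  have h := G.card_add_one_le_numComponentsDelete hIS hN hxS hxI
  have h1 := hG S (by have := hI.card_pos; omega)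
  rw [one_mul] at h1
  exact h.trans (by exact_mod_cast h1)

theorem IsTough.exists_adj {V : Type*} [Finite V] [Nontrivial V] {G : SimpleGraph V}
    (hG : G.IsTough 1) (v : V) : ∃ w, G.Adj v w := by
  by_contra! h
  obtain ⟨x, hx⟩ := exists_ne v
  have := hG.card_add_one_le (S := ∅) (I := {v}) (by simp) (by simpa using h) (by simp)
    (x := x) (by simp) (by simpa using hx)
  simp at this

/-- In a `1`-tough graph an independent set can be matched into its neighbourhood. -/
theorem exists_matching_of_independent {V : Type*} [Finite V] [Nontrivial V] {G : SimpleGraph V}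
    (hG : G.IsTough 1) {s : Set V} (hs : ∀ u ∈ s, ∀ v ∈ s, ¬ G.Adj u v) :
    ∃ f : s → V, Function.Injective f ∧ ∀ u : s, G.Adj u (f u) := by
  classical
  have := Fintype.ofFinite V
  refine (Fintype.all_card_le_filter_rel_iff_exists_injective
    (fun (u : s) (v : V) => G.Adj u v)).1 fun A => ?_
  rcases A.eq_empty_or_nonempty with rfl | ⟨u, hu⟩
  · simp
  let N : Finset V := {b | ∃ a ∈ A, G.Adj a b}
  let I : Finset V := A.map (Function.Embedding.subtype _)
  have hIA : I.card = A.card := Finset.card_map _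
  have hIs : ∀ v ∈ I, v ∈ s := by simp +contextual [I]
  have hN : ∀ v ∈ I, ∀ w, G.Adj v w → w ∈ N := by
    simp only [I, N, Finset.mem_map, Finset.mem_filter, Finset.mem_univ, true_and]
    rintro _ ⟨a, ha, rfl⟩ w hw
    exact ⟨a, ha, hw⟩
  have hIN : Disjoint I N := by
    refine Finset.disjoint_left.2 fun v hv hv' => ?_
    obtain ⟨a, -, hav⟩ := (Finset.mem_filter.1 hv').2
    exact hs a a.2 v (hIs v hv) hav
  have huI : u.1 ∈ I := Finset.mem_map_of_mem _ hu
  change A.card ≤ N.card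
  rw [← hIA]
  -- Delete `N` and compare the vertices of `I` other than `u` with the extra vertex `u`.
  rcases (I.erase u.1).eq_empty_or_nonempty with h | h
  · have h1 : I.card = 1 := by
      have := Finset.card_erase_add_one huI
      rw [h] at this
      simpa using this.symm
    obtain ⟨w, hw⟩ := hG.exists_adj u.1
    rw [h1]
    exact Finset.card_pos.2 ⟨w, hN _ huI w hw⟩
  · have := hG.card_add_one_le (S := N) (I := I.erase u.1)
      (hIN.mono_left (Finset.erase_subset _ _))
      (fun v hv => hN v (Finset.mem_of_mem_erase hv)) h (x := u.1)
      (Finset.disjoint_left.1 hIN huI) (Finset.notMem_erase _ _)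
    rwa [Finset.card_erase_add_one huI] at this

/-! ### Induced pairs of disjoint edges -/

theorem IsTwoKTwoFree.exists_adj_between {V : Type*} {G : SimpleGraph V} (hG : G.IsTwoKTwoFree)
    {a b c d : V} (hab : G.Adj a b) (hcd : G.Adj c d) :
    G.Adj a c ∨ G.Adj a d ∨ G.Adj b c ∨ G.Adj b d := by
  by_contra! h
  obtain ⟨hac, had, hbc, hbd⟩ := h
  have h1 : a ≠ c := by rintro rfl; exact had hcd
  have h2 : a ≠ d := by rintro rfl; exact hac hcd.symm
  have h3 : b ≠ c := by rintro rfl; exact hbd hcd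
  have h4 : b ≠ d := by rintro rfl; exact hbc hcd.symm
  have h5 := hab.ne
  have h6 := hcd.ne
  refine hG ⟨⟨⟨Sum.elim ![a, b] ![c, d], ?_⟩, fun {x y} => ?_⟩⟩
  · rintro (i | i) (j | j) <;> fin_cases i <;> fin_cases j <;> simp_all [eq_comm]
  · change G.Adj (Sum.elim ![a, b] ![c, d] x) (Sum.elim ![a, b] ![c, d] y) ↔ _
    rcases x with i | i <;> rcases y with j | j <;> fin_cases i <;> fin_cases j <;>
      simp_all [twoKTwo, adj_comm]

/-! ### Longest cycles are dominating -/

/-- A cyclic sequence of vertices can be cut open in front of any of its members. The irreflexivity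
of adjacency excludes sequences of length one. -/
theorem exists_eq_cons_cons_of_chain {V : Type*} [DecidableEq V] {G : SimpleGraph V} {C : Cycle V}
    (hn : C.Nodup) (hC : C.Chain G.Adj) {a : V} (ha : a ∈ C) :
    ∃ l : List V, C = ((a :: C.next hn a ha :: l : List V) : Cycle V) := by
  obtain ⟨l, rfl⟩ : ∃ l : List V, C = ((a :: l : List V) : Cycle V) := by
    induction C using Quotient.inductionOn' with
    | h l =>
      obtain ⟨s, t, rfl⟩ := List.append_of_mem (show a ∈ l from ha)
      exact ⟨t ++ s, Cycle.coe_eq_coe.2 (List.isRotated_append (l := s) (l' := a :: t))⟩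
  cases l with
  | nil => exact absurd ((Cycle.chain_singleton _ _).1 hC) (G.irrefl)
  | cons d l =>
    refine ⟨l, ?_⟩
    have : Cycle.next ((a :: d :: l : List V) : Cycle V) hn a ha = d :=
      List.next_cons_cons_eq (l := l) (x := a) d ha
    rw [this]

/-- If two consecutive vertices of a cycle have neighbours in the same component of the rest of the
graph, then a path through that component can be inserted between them. -/
theorem exists_longer_cycle {V : Type*} [DecidableEq V] {G : SimpleGraph V} {C : Cycle V}
    (hn : C.Nodup) (hC : C.Chain G.Adj) {a : V} (ha : a ∈ C) {k k' : {z | z ∉ C}}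
    (hk : G.Adj a k) (hk' : G.Adj (C.next hn a ha) k')
    (hr : (G.induce {z | z ∉ C}).Reachable k k') :
    ∃ D : Cycle V, D.Nodup ∧ D.Chain G.Adj ∧ C.length < D.length := by
  obtain ⟨l, hl⟩ := exists_eq_cons_cons_of_chain hn hC ha
  generalize C.next hn a ha = d at hk' hl
  obtain ⟨p, hp⟩ := hr.exists_isPath
  let w : List V := p.support.map Subtype.val
  have hw : w.Nodup := hp.support_nodup.map Subtype.val_injective
  have hwC : ∀ z ∈ w, z ∉ C := by
    intro z hz
    obtain ⟨y, -, rfl⟩ := List.mem_map.1 hz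
    exact y.2
  have hwchain : w.IsChain G.Adj := by
    refine (List.isChain_map _).2 ?_
    exact p.isChain_adj_support
  have hhead : w.head? = some k.1 := by
    simp only [w, List.head?_map, List.head?_eq_some_head p.support_ne_nil, Walk.head_support,
      Option.map_some]
  have hlast : w.getLast? = some k'.1 := by
    simp only [w, List.getLast?_map, List.getLast?_eq_some_getLast p.support_ne_nil,
      Walk.getLast_support, Option.map_some]
  refine ⟨((a :: (w ++ d :: l) : List V) : Cycle V), ?_, ?_, ?_⟩
  · have hn' : (a :: d :: l).Nodup := by rw [hl] at hn; exact hn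
    have hmem : ∀ z ∈ w, z ∉ a :: d :: l := by
      intro z hz
      have := hwC z hz
      rw [hl] at this
      exact this
    rw [Cycle.nodup_coe_iff]
    rw [List.nodup_cons] at hn' ⊢
    refine ⟨?_, ?_⟩
    · rw [List.mem_append]
      rintro (h | h)
      · exact hmem a h (by simp)
      · exact hn'.1 h
    · refine List.nodup_append'.2 ⟨hw, hn'.2, ?_⟩
      intro z hz hz'
      exact hmem z hz (List.mem_cons_of_mem _ hz')
  · rw [hl, Cycle.chain_coe_cons] at hC
    have hC' := (List.isChain_cons_cons.1 hC).2
    rw [Cycle.chain_coe_cons, List.append_assoc, List.isChain_cons, List.isChain_append]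
    refine ⟨?_, hwchain, hC', ?_⟩
    · intro y hy
      rw [List.head?_append, hhead] at hy
      simp only [Option.some_or, Option.mem_def, Option.some.injEq] at hy
      exact hy ▸ hk
    · intro y hy z hz
      rw [hlast] at hy
      simp only [Option.mem_def, Option.some.injEq] at hy
      simp only [List.cons_append, List.head?_cons, Option.mem_def, Option.some.injEq] at hz
      subst hy hz
      exact hk'.symm
  · have : 0 < w.length := by simp [w]
    rw [hl]
    simp only [Cycle.length_coe, List.length_cons, List.length_append]
    omega

theorem exists_dominating_cycle {V : Type*} [Finite V] [DecidableEq V] {G : SimpleGraph V}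
    (hG : G.IsTough 1) (hfree : G.IsTwoKTwoFree) {u v : V} (huv : G.Adj u v) :
    ∃ C : Cycle V, C.Nodup ∧ C.Chain G.Adj ∧ C ≠ Cycle.nil ∧
      ∀ x y, G.Adj x y → x ∈ C ∨ y ∈ C := by
  classical
  have := Fintype.ofFinite V
  let F : Set (Cycle V) := {C | C.Nodup ∧ C.Chain G.Adj ∧ C ≠ Cycle.nil}
  have hfin : F.Finite := by
    have h : Finite {C : Cycle V // C.Nodup} := Finite.of_fintype _
    exact (show {C : Cycle V | C.Nodup}.Finite from h).subset fun C hC => hC.1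
  have hne : F.Nonempty := by
    refine ⟨(([u, v] : List V) : Cycle V), ?_, ?_, ?_⟩
    · simpa using huv.ne
    · rw [Cycle.chain_coe_cons]
      simpa using ⟨huv, huv.symm⟩
    · simp
  obtain ⟨C, ⟨hn, hC, hnil⟩, hmax⟩ := Set.exists_max_image F Cycle.length hfin hne
  refine ⟨C, hn, hC, hnil, ?_⟩
  intro x y hxy
  by_contra! hcon
  obtain ⟨hx, hy⟩ := hcon
  let H := G.induce {z | z ∉ C}
  let K : Set V := {z | ∃ hz : z ∉ C, H.Reachable ⟨x, hx⟩ ⟨z, hz⟩}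
  have hxK : x ∈ K := ⟨hx, Reachable.refl _⟩
  have hyK : y ∈ K := ⟨hy, Adj.reachable (G := H) (show G.Adj x y from hxy)⟩
  let A : Finset V := C.toFinset.filter fun a => ∃ k ∈ K, G.Adj a k
  have hmem : ∀ z, z ∈ C.toFinset ↔ z ∈ C := by
    intro z
    induction C using Quotient.inductionOn' with
    | h l => exact List.mem_toFinset
  have hAC : A ⊆ C.toFinset := Finset.filter_subset _ _
  have hAmem : ∀ a, a ∈ A ↔ a ∈ C ∧ ∃ k ∈ K, G.Adj a k := by
    intro a
    rw [Finset.mem_filter, hmem]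
  have hnext : ∀ a (ha : a ∈ A), C.next hn a ((hAmem a).1 ha).1 ∉ A := by
    intro a ha ha'
    obtain ⟨haC, k, ⟨hk, hxk⟩, hak⟩ := (hAmem a).1 ha
    obtain ⟨-, k', ⟨hk', hxk'⟩, hak'⟩ := (hAmem _).1 ha'
    obtain ⟨D, hDn, hD, hlt⟩ := exists_longer_cycle hn hC haC (k := ⟨k, hk⟩) (k' := ⟨k', hk'⟩)
      hak hak' (hxk.symm.trans hxk')
    refine absurd (hmax D ⟨hDn, hD, ?_⟩) (not_le.2 hlt)
    rintro rfl
    simp at hlt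
  let B : Finset V := C.toFinset \ A
  have hcard : A.card ≤ B.card := by
    -- Passing to the successor on `C` maps `A` injectively into `B`.
    refine Finset.card_le_card_of_injOn
      (fun a => if ha : a ∈ C then C.next hn a ha else a) ?_ ?_
    · intro a ha
      have haC := ((hAmem a).1 ha).1
      simp only [dif_pos haC]
      exact Finset.mem_sdiff.2 ⟨(hmem _).2 (C.next_mem hn a haC), hnext a ha⟩
    · intro a ha b hb hab
      have haC := ((hAmem a).1 ha).1
      have hbC := ((hAmem b).1 hb).1
      simp only [dif_pos haC, dif_pos hbC] at hab
      have h1 := C.prev_next hn a haC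
      have h2 := C.prev_next hn b hbC
      simp only [hab] at h1
      exact h1.symm.trans h2
  have hB : B.Nonempty := by
    rw [← Finset.card_pos]
    by_contra h0
    have h1 : (C.toFinset \ A).card + A.card = C.toFinset.card :=
      Finset.card_sdiff_add_card_eq_card hAC
    have h2 : C.toFinset.card = 0 := by
      change B.card + A.card = _ at h1
      omega
    exact hnil (Cycle.toFinset_eq_nil.1 (Finset.card_eq_zero.1 h2))
  have hiso : ∀ b ∈ B, ∀ w, G.Adj b w → w ∈ A := by
    intro b hb w hbw
    obtain ⟨hbC, hbA⟩ := Finset.mem_sdiff.1 hb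
    have hbK : ∀ k ∈ K, ¬ G.Adj b k := fun k hk h => hbA ((hAmem b).2 ⟨(hmem b).1 hbC, k, hk, h⟩)
    -- By `2K₂`-freeness `w` has a neighbour in `K`, so it lies on `C` or in `K` itself.
    have hwK : ∃ k ∈ K, G.Adj w k := by
      rcases hfree.exists_adj_between hbw hxy with h | h | h | h
      · exact absurd h (hbK x hxK)
      · exact absurd h (hbK y hyK)
      · exact ⟨x, hxK, h⟩
      · exact ⟨y, hyK, h⟩
    by_cases hwC : w ∈ C
    · exact (hAmem w).2 ⟨hwC, hwK⟩
    · obtain ⟨k, ⟨hk, hxk⟩, hwk⟩ := hwK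
      refine absurd hbw (hbK w ⟨hwC, hxk.trans ?_⟩)
      exact Adj.reachable (G := H) (show G.Adj k w from hwk.symm)
  have := hG.card_add_one_le (S := A) (I := B) Finset.sdiff_disjoint hiso hB (x := x)
    (fun h => hx ((hAmem x).1 h).1)
    (fun h => hx ((hmem x).1 (Finset.mem_sdiff.1 h).1))
  omega

/-! ### Closed walks with detours -/

theorem exists_closedWalk_of_cycle {V : Type*} [DecidableEq V] {G : SimpleGraph V} {C : Cycle V}
    (hn : C.Nodup) (hC : C.Chain G.Adj) (hnil : C ≠ Cycle.nil) :
    ∃ (v : V) (p : G.Walk v v), ∀ w, p.support.tail.count w = if w ∈ C then 1 else 0 := by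
  induction C using Quotient.inductionOn' with
  | h l =>
    cases l with
    | nil => exact absurd rfl hnil
    | cons a l =>
      have hchain : List.IsChain G.Adj (a :: (l ++ [a])) := hC
      obtain ⟨p, hp⟩ : ∃ p : G.Walk a a, p.support = a :: (l ++ [a]) :=
        ⟨(Walk.ofSupport _ (List.cons_ne_nil _ _) hchain).copy (by simp) (by simp),
          (Walk.support_copy _ _ _).trans (Walk.support_ofSupport _ _)⟩
      refine ⟨a, p, fun w => ?_⟩
      rw [hp, List.tail_cons,
        (List.perm_append_singleton a l).count_eq, List.Nodup.count (show (a :: l).Nodup from hn)]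
      rfl

/-- A detour `c, u, c` can be inserted into a closed walk through `c`. -/
theorem exists_closedWalk_insert_detour {V : Type*} [DecidableEq V] {G : SimpleGraph V} {v : V}
    (p : G.Walk v v) {c u : V} (hc : c ∈ p.support) (huc : G.Adj u c) :
    ∃ q : G.Walk c c, ∀ w, q.support.tail.count w =
      p.support.tail.count w + (if u = w then 1 else 0) + (if c = w then 1 else 0) := by
  refine ⟨.cons huc.symm (.cons huc (p.rotate c hc)), fun w => ?_⟩
  rw [← (p.support_rotate c hc).perm.count_eq]
  have h : (p.rotate c hc).support = c :: (p.rotate c hc).support.tail :=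
    (p.rotate c hc).cons_tail_support.symm
  rw [Walk.support_cons, Walk.support_cons, List.tail_cons, h, List.tail_cons,
    List.count_cons, List.count_cons]
  simp only [beq_iff_eq]
  omega

/-- Detours to the vertices `g i` from the vertices `f i` of a cycle can be inserted
simultaneously. -/
theorem exists_closedWalk_with_detours {V ι : Type*} [DecidableEq V] {G : SimpleGraph V}
    {C : Cycle V} (hn : C.Nodup) (hC : C.Chain G.Adj) (hnil : C ≠ Cycle.nil) (g f : ι → V)
    (hf : ∀ i, f i ∈ C) (hgf : ∀ i, G.Adj (g i) (f i)) (s : Finset ι) :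
    ∃ (v : V) (p : G.Walk v v), ∀ w, p.support.tail.count w =
      (if w ∈ C then 1 else 0) + (s.filter (g · = w)).card + (s.filter (f · = w)).card := by
  classical
  induction s using Finset.induction_on with
  | empty => simpa using exists_closedWalk_of_cycle hn hC hnil
  | insert i s hi ih =>
    obtain ⟨v, p, hp⟩ := ih
    have hmem : f i ∈ p.support := by
      refine List.mem_of_mem_tail (List.count_pos_iff.1 ?_)
      rw [hp, if_pos (hf i)]
      omega
    obtain ⟨q, hq⟩ := exists_closedWalk_insert_detour p hmem (hgf i)
    refine ⟨_, q, fun w => ?_⟩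
    have hcard : ∀ h : ι → V, ((insert i s).filter (h · = w)).card =
        (s.filter (h · = w)).card + if h i = w then 1 else 0 := by
      intro h
      rw [Finset.filter_insert]
      split_ifs
      · exact Finset.card_insert_of_notMem fun h' => hi (Finset.mem_filter.1 h').1
      · rfl
    rw [hq, hp, hcard g, hcard f]
    omega

/-- `1`-toughness is enough for a `2`-walk in a `2K₂`-free graph. -/
theorem IsTough.hasKWalk_two {V : Type*} [Finite V] [Nonempty V] [DecidableEq V]
    {G : SimpleGraph V} (hG : G.IsTough 1) (hfree : G.IsTwoKTwoFree) : G.HasKWalk 2 := by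
  cases subsingleton_or_nontrivial V with
  | inl _ =>
    obtain ⟨v⟩ := ‹Nonempty V›
    exact ⟨v, .nil, fun u => by simp [Subsingleton.elim u v], fun u => by simp⟩
  | inr _ =>
    obtain ⟨v⟩ := ‹Nonempty V›
    obtain ⟨w, hvw⟩ := hG.exists_adj v
    obtain ⟨C, hn, hC, hnil, hdom⟩ := exists_dominating_cycle hG hfree hvw
    obtain ⟨f, hf, hadj⟩ := exists_matching_of_independent hG (s := {u | u ∉ C})
      fun a ha b hb hab => (hdom a b hab).elim ha hb
    have hfC : ∀ i, f i ∈ C := fun i => (hdom _ _ (hadj i)).resolve_left i.2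
    obtain ⟨t, ht⟩ : ∃ t : Finset {u | u ∉ C}, ∀ i, i ∈ t :=
      ⟨Set.finite_univ.toFinset, by simp⟩
    obtain ⟨v, p, hp⟩ := exists_closedWalk_with_detours (ι := {u | u ∉ C}) hn hC hnil
      (fun i => i.1) f hfC hadj t
    have hcard : ∀ (h : {u | u ∉ C} → V), Function.Injective h → ∀ u,
        (t.filter (h · = u)).card ≤ 1 := by
      intro h hh u
      refine Finset.card_le_one.2 fun a ha b hb => hh ?_
      rw [(Finset.mem_filter.1 ha).2, (Finset.mem_filter.1 hb).2]
    -- A vertex of `C` is visited once by `C` and by at most one detour; a vertex off `C` lies on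
    -- exactly one detour and is the base of none.
    refine ⟨v, p, fun u => ?_, fun u => ?_⟩
    · refine List.mem_of_mem_tail (List.count_pos_iff.1 ?_)
      rw [hp]
      by_cases hu : u ∈ C
      · rw [if_pos hu]
        omega
      · have : 0 < (t.filter fun i => i.1 = u).card :=
          Finset.card_pos.2 ⟨⟨u, hu⟩, Finset.mem_filter.2 ⟨ht _, rfl⟩⟩
        omega
    · rw [hp]
      have h1 := hcard f hf u
      have h2 := hcard (fun i => i.1) Subtype.val_injective u
      by_cases hu : u ∈ C
      · have h3 : (t.filter fun i => i.1 = u).card = 0 := by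
          refine Finset.card_eq_zero.2 (Finset.filter_eq_empty_iff.2 ?_)
          rintro ⟨z, hz⟩ - rfl
          exact hz hu
        rw [if_pos hu]
        omega
      · rw [if_neg hu]
        omega

end SimpleGraph

theorem mainTheorem1 {V : Type*} [Finite V] [Nonempty V] [DecidableEq V]
    (G : SimpleGraph V) (hG : G.IsTough 2) (hfree : G.IsTwoKTwoFree) :
    G.HasKWalk 2 :=
  (hG.mono one_le_two).hasKWalk_two hfree
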